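/- Let $m$ be the number of goods, let $H$ be a real number, and let $\mathcal V$ be any class of valuations $v:2^{[m]}\to[0,H]$ that are monotone with $v(\emptyset)=0$. For prices $p\in\mathbb R_{\ge 0}^m$ let $\mathrm{Dem}_v(p)$ be the set of bundles $S\subseteq[m]$ maximizing $v(S)-\sum_{g\in S}p_g$. A tie-breaking rule $e$ assigns to a collection of bundles and a valuation $v\in\mathcal V$ a bundle; the canonical bundle of $v$ at $p$ is $B_v(p)=e(\mathrm{Dem}_v(p),v)$. The rule $e$ is encodable if there are a vector $y\in\mathbb R_{\ge0}^m$ and, for each $v\in\mathcal V$, a set $\mathcal L_v\subseteq 2^{[m]}$ such that for all $v\in\mathcal V$ and all $p$: some bundle of $\mathrm{Dem}_v(p)$ lies outside $\mathcal L_v$, $B_v(p)\in \mathrm{Dem}_v(p)\setminus\mathcal L_v$, and $\sum_{g\in B_v(p)}y_g>\sum_{g\in B'}y_g$ for every other $B'\in\mathrm{Dem}_v(p)\setminus\mathcal L_v$. A valuation is unit demand if $v(S)=\max_{g\in S}v(\{g\})$ for all nonempty $S$. A finite set $S\subseteq\mathcal V$ is shatterable by a class $\mathcal F$ of functions $\mathcal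 V\to\mathbb R$ if there are real targets $(r_v)_{v\in S}$ such that for each $T\subseteq S$ some $c\in\mathcal F$ has $c(v)\ge r_v$ for $v\in T$ and $c(v)<r_v$ for $v\in S\setminus T$; the pseudo-dimension of $\mathcal F$ is the largest size of a shatterable set. Suppose that $e$ is encodable, and let $\mathcal H_V=\{\,v\mapsto v(B_v(p)) : p\in\mathbb R_{\ge0}^m\,\}$ be the class of welfare predictors. 1. The pseudo-dimension of $\mathcal H_V$ is $O(m^2\ln m)$, and it is $O(m\ln^3 m)$ if all valuations in $\mathcal V$ are unit demand. That is, there are absolute constants $C,C'>0$ such that for all $m\ge2$ (and all $H$, $\mathcal V$ and encodable $e$) it is finite and at most $C\,m^2\ln m$, respectively $C'\,m\ln^3 m$. 2. For every $m\ge 0$, every $n\ge m+1$ and every sample $v_1,\dots,v_n\in\mathcal V$ (repetitions allowed), the number of distinct bundle labelings $(B_{v_1}(p),\dots,B_{v_n}(p))$, $p\in\mathbb R_{\ge0}^m$, is at most $\binom{n}{m+1}2^{m(m+1)}$. If all valuations in $\mathcal V$ are unit demand, it is at most $\binom{n}{m+1}(m+1)^{m+1}$, and for $m\ge 3$ it is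 even at most $\binom{n}{m+1}m^{m+1}$. -/

import Mathlib

open scoped NNReal

noncomputable section

namespace Market

/-- A valuation on bundles of the `m` goods: a monotone function with values in `[0, H]` that
vanishes on the empty bundle. -/
structure BundleValuation (m : ℕ) (H : ℝ) where
  val : Finset (Fin m) → ℝ
  nonneg : ∀ S, 0 ≤ val S
  le_bound : ∀ S, val S ≤ H
  mono : ∀ S T, S ⊆ T → val S ≤ val T
  empty : val ∅ = 0

variable {m : ℕ} {H : ℝ}

/-- `v` is unit demand: a nonempty bundle is worth as much as its best single good. -/
def BundleValuation.IsUnitDemand (v : BundleValuation m H) : Prop :=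
  ∀ (S : Finset (Fin m)) (hS : S.Nonempty), v.val S = S.sup' hS (fun g => v.val {g})

/-- Quasi-linear utility of the bundle `S` at the prices `p`. -/
def utility (v : BundleValuation m H) (p : Fin m → ℝ≥0) (S : Finset (Fin m)) : ℝ :=
  v.val S - ∑ g ∈ S, (p g : ℝ)

open Classical in
/-- Demand correspondence: all utility-maximizing bundles at the prices `p`. -/
def demand (v : BundleValuation m H) (p : Fin m → ℝ≥0) : Finset (Finset (Fin m)) :=
  Finset.univ.filter (fun S => ∀ T, utility v p T ≤ utility v p S)

/-- A tie-breaking rule for a class `V` of valuations: it maps a collection of bundles and a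
valuation to a bundle. -/
abbrev TieBreaking (V : Set (BundleValuation m H)) : Type :=
  Finset (Finset (Fin m)) → V → Finset (Fin m)

/-- The canonical bundle of `v` at `p`: the bundle that the rule selects from the demand set. -/
def canonicalBundle {V : Set (BundleValuation m H)} (e : TieBreaking V)
    (p : Fin m → ℝ≥0) (v : V) : Finset (Fin m) :=
  e (demand v.1 p) v

/-- Encodable tie-breaking. There are a separator `y ≥ 0`, common to all valuations, and for each
valuation a set `L v` of infeasible bundles such that, on every demand set, some bundle is
feasible, and the rule selects a feasible bundle of the demand set whose `y`-weight is strictly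
larger than that of every other feasible bundle there. (Only collections that arise as demand sets
are constrained: no rule can do this on an empty collection or on one inside `L v`.) -/
def IsEncodable {V : Set (BundleValuation m H)} (e : TieBreaking V) : Prop :=
  ∃ (y : Fin m → ℝ≥0) (L : V → Set (Finset (Fin m))), ∀ (v : V) (p : Fin m → ℝ≥0),
    (∃ B ∈ demand v.1 p, B ∉ L v) ∧
    canonicalBundle e p v ∈ demand v.1 p ∧
    canonicalBundle e p v ∉ L v ∧
    ∀ B ∈ demand v.1 p, B ∉ L v → B ≠ canonicalBundle e p v →
      ∑ g ∈ B, y g < ∑ g ∈ canonicalBundle e p v, y g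

/-- The class of bundle predictors: one function for each price vector. -/
def bundlePredictors {V : Set (BundleValuation m H)} (e : TieBreaking V) :
    Set (V → Finset (Fin m)) :=
  Set.range (fun p : Fin m → ℝ≥0 => fun v : V => canonicalBundle e p v)

/-- The class of welfare predictors: one function for each price vector. -/
def welfarePredictors {V : Set (BundleValuation m H)} (e : TieBreaking V) : Set (V → ℝ) :=
  Set.range (fun p : Fin m → ℝ≥0 => fun v : V => v.1.val (canonicalBundle e p v))

/-- All labelings of the sample `s` that functions of the class `F` induce. -/
def inducedLabelings {X Y : Type*} (F : Set (X → Y)) {n : ℕ} (s : Fin n → X) :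
    Set (Fin n → Y) :=
  {l | ∃ f ∈ F, ∀ q, l q = f (s q)}

/-- `S` is shatterable by the real-valued class `F`, witnessed by some targets `r`. -/
def PseudoShatters {X : Type*} (F : Set (X → ℝ)) (S : Finset X) : Prop :=
  ∃ r : X → ℝ, ∀ T ⊆ S, ∃ c ∈ F, (∀ x ∈ T, r x ≤ c x) ∧ (∀ x ∈ S, x ∉ T → c x < r x)

/-- Pseudo-dimension: the supremum of the sizes of shatterable finite sets. -/
def pseudoDim {X : Type*} (F : Set (X → ℝ)) : ℕ∞ :=
  ⨆ (S : Finset X) (_ : PseudoShatters F S), (S.card : ℕ∞)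

end Market

end

namespace Market

variable {m n : ℕ} {H : ℝ} {V : Set (BundleValuation m H)} {e : TieBreaking V}

theorem mem_demand {v : BundleValuation m H} {p : Fin m → ℝ≥0} {S : Finset (Fin m)} :
    S ∈ demand v p ↔ ∀ T, utility v p T ≤ utility v p S := by
  simp [demand]

/-! ### Aggregate demand determines the labeling -/

/-- The number of buyers whose bundle under the labeling `l` contains the good `g`. -/
def demandCount (l : Fin n → Finset (Fin m)) (g : Fin m) : ℕ :=
  (Finset.univ.filter fun q => g ∈ l q).card

theorem demandCount_le (l : Fin n → Finset (Fin m)) (g : Fin m) : demandCount l g ≤ n :=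
  (Finset.card_filter_le _ _).trans_eq (by simp)

theorem sum_price_eq_sum_demandCount (l : Fin n → Finset (Fin m)) (p : Fin m → ℝ) :
    ∑ q, ∑ g ∈ l q, p g = ∑ g, (demandCount l g : ℝ) * p g := by
  have h : ∀ q, ∑ g ∈ l q, p g = ∑ g, if g ∈ l q then p g else 0 := fun q => by simp
  simp_rw [h]
  rw [Finset.sum_comm]
  refine Finset.sum_congr rfl fun g _ => ?_
  rw [← Finset.sum_filter, Finset.sum_const, nsmul_eq_mul, demandCount]

/-- Two price vectors induce the same labeling as soon as they induce the same demand for every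
good that has a positive price under one of them. -/
theorem canonicalBundle_eq_of_demandCount_eq (he : IsEncodable e) (s : Fin n → V)
    {p p' : Fin m → ℝ≥0}
    (h : ∀ g, p g ≠ 0 ∨ p' g ≠ 0 → demandCount (fun q => canonicalBundle e p (s q)) g =
      demandCount (fun q => canonicalBundle e p' (s q)) g) (q : Fin n) :
    canonicalBundle e p (s q) = canonicalBundle e p' (s q) := by
  obtain ⟨y, L, hy⟩ := he
  set l := fun q => canonicalBundle e p (s q) with hl
  set l' := fun q => canonicalBundle e p' (s q) with hl'
  -- Goods that are free under both price vectors drop out of total payments, so their counts need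
  -- not agree.
  have hc : ∀ r : Fin m → ℝ≥0, (∀ g, r g ≠ 0 → p g ≠ 0 ∨ p' g ≠ 0) →
      ∑ q, ∑ g ∈ l q, (r g : ℝ) = ∑ q, ∑ g ∈ l' q, (r g : ℝ) := by
    intro r hr
    rw [sum_price_eq_sum_demandCount, sum_price_eq_sum_demandCount]
    refine Finset.sum_congr rfl fun g _ => ?_
    by_cases h0 : r g = 0
    · simp [h0]
    · rw [h g (hr g h0)]
  have hp := hc p fun g => Or.inl
  have hp' := hc p' fun g => Or.inr
  have hle : ∀ q, utility (s q).1 p (l' q) ≤ utility (s q).1 p (l q) := fun q =>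
    mem_demand.1 (hy (s q) p).2.1 _
  have hle' : ∀ q, utility (s q).1 p' (l q) ≤ utility (s q).1 p' (l' q) := fun q =>
    mem_demand.1 (hy (s q) p').2.1 _
  have hs := Finset.sum_le_sum fun q (_ : q ∈ Finset.univ) => hle q
  have hs' := Finset.sum_le_sum fun q (_ : q ∈ Finset.univ) => hle' q
  have heq : ∀ q, utility (s q).1 p (l' q) = utility (s q).1 p (l q) := by
    have := (Finset.sum_eq_sum_iff_of_le fun q (_ : q ∈ Finset.univ) => hle q).1 (by
      simp only [utility, Finset.sum_sub_distrib] at hs hs' ⊢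
      linarith)
    exact fun q => this q (Finset.mem_univ q)
  have heq' : ∀ q, utility (s q).1 p' (l q) = utility (s q).1 p' (l' q) := by
    have := (Finset.sum_eq_sum_iff_of_le fun q (_ : q ∈ Finset.univ) => hle' q).1 (by
      simp only [utility, Finset.sum_sub_distrib] at hs hs' ⊢
      linarith)
    exact fun q => this q (Finset.mem_univ q)
  by_contra hne
  -- Feasibility does not depend on prices, so each bundle is a feasible competitor of the other,
  -- and each gets strictly smaller `y`-weight.
  have h1 := (hy (s q) p).2.2.2 (l' q)
    (mem_demand.2 fun T => (mem_demand.1 (hy (s q) p).2.1 T).trans (heq q).ge)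
    (hy (s q) p').2.2.1 (Ne.symm hne)
  have h2 := (hy (s q) p').2.2.2 (l q)
    (mem_demand.2 fun T => (mem_demand.1 (hy (s q) p').2.1 T).trans (heq' q).ge)
    (hy (s q) p).2.2.1 hne
  exact lt_asymm h1 h2

theorem mem_inducedLabelings_bundlePredictors {s : Fin n → V} {l : Fin n → Finset (Fin m)} :
    l ∈ inducedLabelings (bundlePredictors e) s ↔
      ∃ p : Fin m → ℝ≥0, l = fun q => canonicalBundle e p (s q) := by
  constructor
  · rintro ⟨_, ⟨p, rfl⟩, h⟩
    exact ⟨p, funext h⟩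
  · rintro ⟨p, rfl⟩
    exact ⟨_, ⟨p, rfl⟩, fun _ => rfl⟩

/-- The demand for each good determines the bundle labeling. -/
theorem ncard_inducedLabelings_le (he : IsEncodable e) (s : Fin n → V) :
    (inducedLabelings (bundlePredictors e) s).ncard ≤ (n + 1) ^ m := by
  have := Set.ncard_le_ncard_of_injOn (t := (Set.univ : Set (Fin m → Fin (n + 1))))
    (s := inducedLabelings (bundlePredictors e) s)
    (fun l g => ⟨demandCount l g, Nat.lt_succ_of_le (demandCount_le l g)⟩)
    (fun _ _ => Set.mem_univ _) (by
      intro l hl l' hl' h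
      obtain ⟨p, rfl⟩ := mem_inducedLabelings_bundlePredictors.1 hl
      obtain ⟨p', rfl⟩ := mem_inducedLabelings_bundlePredictors.1 hl'
      funext q
      refine canonicalBundle_eq_of_demandCount_eq he s (fun g _ => ?_) q
      simpa using congrFun h g)
  simpa [Set.ncard_univ] using this

/-! ### Pseudo-dimension -/

/-- Shattering `d` valuations takes `2 ^ d` bundle labelings. -/
theorem two_pow_card_le_of_pseudoShatters (he : IsEncodable e) {S : Finset V}
    (hS : PseudoShatters (welfarePredictors e) S) : 2 ^ S.card ≤ (S.card + 1) ^ m := by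
  classical
  obtain ⟨r, hr⟩ := hS
  let s : Fin S.card → V := fun q => (S.equivFin.symm q).1
  choose c hc hcT hcS using fun T : {T // T ∈ S.powerset} => hr T.1 (Finset.mem_powerset.1 T.2)
  choose p hp using hc
  have hinj : Function.Injective fun (T : {T // T ∈ S.powerset}) (q : Fin S.card) =>
      canonicalBundle e (p T) (s q) := by
    intro T T' h
    have key : ∀ T T' : {T // T ∈ S.powerset},
        (fun q : Fin S.card => canonicalBundle e (p T) (s q)) =
          (fun q => canonicalBundle e (p T') (s q)) → T.1 ⊆ T'.1 := by
      intro T T' h x hx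
      by_contra hx'
      have hxS := Finset.mem_powerset.1 T.2 hx
      have h1 := hcT T x hx
      have h2 := hcS T' x hxS hx'
      have h3 := congrFun h (S.equivFin ⟨x, hxS⟩)
      simp only [s, Equiv.symm_apply_apply] at h3
      rw [← hp] at h1 h2
      simp only [h3] at h1
      exact absurd h1 (not_le.2 h2)
    exact Subtype.ext ((key T T' h).antisymm (key T' T h.symm))
  refine le_trans ?_ (ncard_inducedLabelings_le he s)
  have := Set.ncard_le_ncard_of_injOn (s := (Set.univ : Set {T // T ∈ S.powerset}))
    (t := inducedLabelings (bundlePredictors e) s) _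
    (fun T _ => mem_inducedLabelings_bundlePredictors.2 ⟨p T, rfl⟩) hinj.injOn (Set.toFinite _)
  rwa [Set.ncard_univ, Nat.card_eq_fintype_card, Fintype.card_coe, Finset.card_powerset] at this

theorem exists_pseudoDim_eq (he : IsEncodable e) {b : ℝ} (hb : 0 ≤ b)
    (h : ∀ d : ℕ, 2 ^ d ≤ (d + 1) ^ m → (d : ℝ) ≤ b) :
    ∃ d : ℕ, pseudoDim (welfarePredictors e) = (d : ℕ∞) ∧ (d : ℝ) ≤ b := by
  have hle : pseudoDim (welfarePredictors e) ≤ (⌊b⌋₊ : ℕ∞) := by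
    refine iSup₂_le fun S hS => ?_
    exact_mod_cast Nat.le_floor (h _ (two_pow_card_le_of_pseudoShatters he hS))
  obtain ⟨d, hd⟩ := ENat.ne_top_iff_exists.1 (ne_top_of_le_ne_top (ENat.natCast_ne_top _) hle)
  refine ⟨d, hd.symm, ?_⟩
  rw [← hd] at hle
  exact (Nat.le_floor_iff hb).1 (by exact_mod_cast hle)

theorem le_mul_log_of_two_pow_le (hm : 2 ≤ m) {d : ℕ} (h : 2 ^ d ≤ (d + 1) ^ m) :
    (d : ℝ) ≤ 5 * (m * Real.log m) := by
  have hm' : (2 : ℝ) ≤ m := by exact_mod_cast hm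
  have hl2 := Real.log_two_gt_d9
  have hl2' := Real.log_two_lt_d9
  have hlm : Real.log 2 ≤ Real.log m := Real.log_le_log (by norm_num) hm'
  have h1 : (d : ℝ) * Real.log 2 ≤ m * Real.log (d + 1) := by
    have : (2 : ℝ) ^ d ≤ ((d : ℝ) + 1) ^ m := by exact_mod_cast h
    have := Real.log_le_log (by positivity) this
    rwa [Real.log_pow, Real.log_pow] at this
  have h2 : Real.log (d + 1) ≤ Real.log m + 2 * Real.log 2 + ((d + 1) / (4 * m) - 1) := by
    -- The scale `4 * m` gives `d` the coefficient `1 / 4` on the right, below `log 2`, so it can be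
    -- absorbed on the left.
    have h3 := Real.log_le_sub_one_of_pos (x := ((d : ℝ) + 1) / (4 * m)) (by positivity)
    rw [Real.log_div (by positivity) (by positivity), Real.log_mul (by norm_num) (by positivity),
      show (4 : ℝ) = 2 ^ 2 by norm_num, Real.log_pow] at h3
    norm_num at h3 ⊢
    linarith
  have h3 : (m : ℝ) * Real.log (d + 1) ≤
      m * Real.log m + m * (2 * Real.log 2 - 1) + (d + 1) / 4 := by
    refine (mul_le_mul_of_nonneg_left h2 (by positivity)).trans_eq ?_
    field_simp
    ring
  have h4 : (m : ℝ) * Real.log 2 ≤ m * Real.log m := by gcongr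
  nlinarith [(Nat.cast_nonneg d : (0 : ℝ) ≤ d)]

/-! ### Comparing `(n + 1) ^ m` with binomial coefficients -/

/-- A Bernoulli inequality, `1 - i / a ≤ (a / (a + 1)) ^ i`, cleared of denominators; truncated
subtraction makes it trivial for `i ≥ a`. -/
theorem succ_pow_mul_sub_le (a i : ℕ) : (a + 1) ^ i * (a - i) ≤ a ^ (i + 1) := by
  induction i with
  | zero => simp
  | succ i ih =>
    have h : (a + 1) * (a - (i + 1)) ≤ a * (a - i) := by
      rcases le_or_gt a i with hai | hai
      · simp [Nat.sub_eq_zero_of_le (hai.trans (Nat.le_succ i))]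
      · obtain ⟨b, rfl⟩ := Nat.exists_eq_add_of_lt hai
        rw [show i + b + 1 - (i + 1) = b by omega, show i + b + 1 - i = b + 1 by omega]
        nlinarith
    calc (a + 1) ^ (i + 1) * (a - (i + 1)) = (a + 1) ^ i * ((a + 1) * (a - (i + 1))) := by ring
      _ ≤ (a + 1) ^ i * (a * (a - i)) := by gcongr
      _ = (a + 1) ^ i * (a - i) * a := by ring
      _ ≤ a ^ (i + 1) * a := by gcongr
      _ = a ^ (i + 1 + 1) := by ring

/-- From `n` to `n + 1` the left side grows by at most `(n + 1) / (n + 1 - m)`, the binomial by `(n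
+ 1) / (n - m)`, so one base case suffices. -/
theorem succ_pow_le_choose_mul {K n₀ : ℕ} (hn₀ : m + 1 ≤ n₀)
    (h : (n₀ + 1) ^ m ≤ n₀.choose (m + 1) * K) (hn : n₀ ≤ n) :
    (n + 1) ^ m ≤ n.choose (m + 1) * K := by
  induction n, hn using Nat.le_induction with
  | base => exact h
  | succ n hn ih =>
    have hpos : 0 < n + 1 - (m + 1) := by omega
    refine Nat.le_of_mul_le_mul_right ?_ hpos
    have h1 := succ_pow_mul_sub_le (n + 1) m
    have h2 := Nat.choose_mul_succ_eq n (m + 1)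
    calc (n + 1 + 1) ^ m * (n + 1 - (m + 1)) ≤ (n + 1 + 1) ^ m * (n + 1 - m) := by
          gcongr; omega
      _ ≤ (n + 1) ^ m * (n + 1) := by rw [← pow_succ]; exact h1
      _ ≤ n.choose (m + 1) * K * (n + 1) := by gcongr
      _ = (n + 1).choose (m + 1) * K * (n + 1 - (m + 1)) := by
          rw [mul_right_comm, h2]; ring

theorem add_two_pow_le_pow_succ (hm : 6 ≤ m) : (m + 2) ^ m ≤ m ^ (m + 1) := by
  rcases (show m = 6 ∨ m = 7 ∨ 8 ≤ m by omega) with rfl | rfl | hm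
  · norm_num
  · norm_num
  have hm' : (8 : ℝ) ≤ m := by exact_mod_cast hm
  -- The left side is at most `e ^ 2 < 8`, which explains the threshold `8 ≤ m`.
  have h1 : (1 + 2 / (m : ℝ)) ^ m ≤ 8 := by
    calc (1 + 2 / (m : ℝ)) ^ m ≤ Real.exp (2 / m) ^ m := by
          gcongr
          linarith [Real.add_one_le_exp (2 / (m : ℝ))]
      _ = Real.exp 1 ^ 2 := by
          rw [← Real.exp_nat_mul, ← Real.exp_nat_mul]
          congr 1
          field_simp
          norm_num
      _ ≤ 8 := by nlinarith [Real.exp_one_lt_d9, Real.exp_pos 1]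
  have h2 : ((m : ℝ) + 2) ^ m ≤ (m : ℝ) ^ (m + 1) := by
    calc ((m : ℝ) + 2) ^ m = (m : ℝ) ^ m * (1 + 2 / (m : ℝ)) ^ m := by
          rw [← mul_pow]
          congr 1
          field_simp
      _ ≤ (m : ℝ) ^ m * m := by gcongr; exact h1.trans hm'
      _ = (m : ℝ) ^ (m + 1) := by ring
  exact_mod_cast h2

/-! ### Unit demand: free and priced goods -/

/-- At any prices, a unit demand buyer takes at most one good that is not free. -/
theorem val_eq_of_mem_demand {v : BundleValuation m H} (hv : v.IsUnitDemand)
    {p : Fin m → ℝ≥0} {S : Finset (Fin m)} (hS : S ∈ demand v p) :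
    ∀ h ∈ S, p h ≠ 0 → v.val S = v.val {h} ∧ ∀ g ∈ S, p g ≠ 0 → g = h := by
  intro h hh hph
  obtain ⟨b, hb, hbv⟩ := Finset.exists_mem_eq_sup' ⟨h, hh⟩ (fun g => v.val {g})
  rw [← hv S ⟨h, hh⟩] at hbv
  have key : ∀ g ∈ S, p g ≠ 0 → g = b := by
    intro g hg hpg
    by_contra hgb
    -- Keeping only the best good `b` loses no value and saves every other price.
    have h1 := mem_demand.1 hS {b}
    have h2 : (p b : ℝ) + p g ≤ ∑ i ∈ S, (p i : ℝ) := by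
      rw [← Finset.sum_pair (Ne.symm hgb) (f := fun i => (p i : ℝ))]
      refine Finset.sum_le_sum_of_subset_of_nonneg ?_ fun _ _ _ => NNReal.coe_nonneg _
      intro i hi
      rcases Finset.mem_insert.1 hi with rfl | hi
      · exact hb
      · exact Finset.mem_singleton.1 hi ▸ hg
    have h3 : (0 : ℝ) < p g := NNReal.coe_pos.2 (pos_iff_ne_zero.2 hpg)
    simp only [utility, Finset.sum_singleton] at h1
    linarith
  obtain rfl := key h hh hph
  exact ⟨hbv, key⟩

/-- A unit demand buyer who pays for the good `h` prefers `h` to every free good. -/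
theorem val_lt_val_of_mem_demand {v : BundleValuation m H} (hv : v.IsUnitDemand)
    {p : Fin m → ℝ≥0} {S : Finset (Fin m)} (hS : S ∈ demand v p) {g h : Fin m} (hh : h ∈ S)
    (hph : p h ≠ 0) (hg : p g = 0) : v.val {g} < v.val {h} := by
  have h1 := mem_demand.1 hS {g}
  have h2 : (p h : ℝ) ≤ ∑ i ∈ S, (p i : ℝ) :=
    Finset.single_le_sum (f := fun i => (p i : ℝ)) (fun _ _ => NNReal.coe_nonneg _) hh
  have h3 : (0 : ℝ) < p h := NNReal.coe_pos.2 (pos_iff_ne_zero.2 hph)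
  simp only [utility, Finset.sum_singleton, hg, (val_eq_of_mem_demand hv hS h hh hph).1,
    NNReal.coe_zero] at h1
  linarith

/-- The demand vectors for the priced goods that are compatible with the set `Z` of free goods,
when at most `k g h` of the `n` buyers prefer `h` to `g`. -/
def pricedDemands (n : ℕ) (k : Fin m → Fin m → ℕ) (Z : Finset (Fin m)) :
    Finset (Fin m → Fin (n + 1)) :=
  Finset.univ.filter fun c => ∑ h, (c h : ℕ) ≤ n ∧ ∀ g ∈ Z, ∀ h, (c h : ℕ) ≤ k g h

/-- The number of buyers of the sample `s` that prefer the good `h` to the good `g`. -/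
noncomputable def preferenceCount (s : Fin n → V) (g h : Fin m) : ℕ :=
  (Finset.univ.filter fun q => (s q).1.val {g} < (s q).1.val {h}).card

theorem preferenceCount_self (s : Fin n → V) (g : Fin m) : preferenceCount s g g = 0 := by
  simp [preferenceCount]

theorem preferenceCount_add_le (s : Fin n → V) (g h : Fin m) :
    preferenceCount s g h + preferenceCount s h g ≤ n := by
  classical
  rw [preferenceCount, preferenceCount, ← Finset.card_union_of_disjoint]
  · exact (Finset.card_le_univ _).trans_eq (by simp)
  · exact Finset.disjoint_filter.2 fun q _ h1 h2 => lt_asymm h1 h2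

/-- The demand for the priced goods, as an element of a finite type. -/
noncomputable def pricedDemand (p : Fin m → ℝ≥0) (l : Fin n → Finset (Fin m)) (g : Fin m) : Fin (n + 1) :=
  if p g = 0 then 0 else ⟨demandCount l g, Nat.lt_succ_of_le (demandCount_le l g)⟩

theorem pricedDemand_mem (he : IsEncodable e) (hV : ∀ v ∈ V, v.IsUnitDemand) (s : Fin n → V)
    (p : Fin m → ℝ≥0) :
    pricedDemand p (fun q => canonicalBundle e p (s q)) ∈
      pricedDemands n (preferenceCount s) (Finset.univ.filter fun g => p g = 0) := by
  classical
  obtain ⟨y, L, hy⟩ := he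
  have hd : ∀ q, canonicalBundle e p (s q) ∈ demand (s q).1 p := fun q => (hy (s q) p).2.1
  have hu : ∀ q, (s q).1.IsUnitDemand := fun q => hV _ (s q).2
  refine Finset.mem_filter.2 ⟨Finset.mem_univ _, ?_, ?_⟩
  · calc ∑ h, (pricedDemand p (fun q => canonicalBundle e p (s q)) h : ℕ)
        = ∑ h, ∑ q, if h ∈ canonicalBundle e p (s q) ∧ p h ≠ 0 then 1 else 0 := by
          refine Finset.sum_congr rfl fun h _ => ?_
          by_cases hp : p h = 0 <;> simp [pricedDemand, demandCount, hp]
      _ = ∑ q, ∑ h, if h ∈ canonicalBundle e p (s q) ∧ p h ≠ 0 then 1 else 0 := Finset.sum_comm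
      _ ≤ ∑ q : Fin n, 1 := by
          refine Finset.sum_le_sum fun q _ => ?_
          rw [← Finset.card_filter]
          refine Finset.card_le_one.2 fun a ha b hb => ?_
          rw [Finset.mem_filter] at ha hb
          exact (val_eq_of_mem_demand (hu q) (hd q) b hb.2.1 hb.2.2).2 a ha.2.1 ha.2.2
      _ = n := by simp
  · intro g hg h
    by_cases hp : p h = 0
    · simp [pricedDemand, hp]
    · simp only [pricedDemand, hp, if_false, demandCount, preferenceCount]
      exact Finset.card_le_card fun q hq => Finset.mem_filter.2 ⟨Finset.mem_univ _,
        val_lt_val_of_mem_demand (hu q) (hd q) (Finset.mem_filter.1 hq).2 hp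
          (Finset.mem_filter.1 hg).2⟩

/-- For unit demand valuations, the set of free goods and the demand for the other goods determine
the bundle labeling. -/
theorem ncard_inducedLabelings_le_sum (he : IsEncodable e) (hV : ∀ v ∈ V, v.IsUnitDemand)
    (s : Fin n → V) :
    (inducedLabelings (bundlePredictors e) s).ncard ≤
      ∑ Z, (pricedDemands n (preferenceCount s) Z).card := by
  classical
  choose! p hp using fun l (hl : l ∈ inducedLabelings (bundlePredictors e) s) =>
    mem_inducedLabelings_bundlePredictors.1 hl
  rw [← Finset.card_sigma, ← Set.ncard_coe_finset]
  refine Set.ncard_le_ncard_of_injOn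
    (fun l => ⟨Finset.univ.filter fun g => p l g = 0, pricedDemand (p l) l⟩) ?_ ?_
  · intro l hl
    refine Finset.mem_coe.2 (Finset.mem_sigma.2 ⟨Finset.mem_univ _, ?_⟩)
    have := pricedDemand_mem he hV s (p l)
    rwa [← hp l hl] at this
  · intro l hl l' hl' h
    obtain ⟨hZ, hc⟩ := Sigma.mk.inj_iff.1 h
    have hc := eq_of_heq hc
    have hZ' : ∀ g, p l g = 0 ↔ p l' g = 0 := fun g => by
      simpa using congrArg (g ∈ ·) hZ
    rw [hp l hl, hp l' hl']
    funext q
    refine canonicalBundle_eq_of_demandCount_eq he s (fun g hg => ?_) q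
    rw [← hp l hl, ← hp l' hl']
    -- The zero sets agree, so a good priced under one vector is priced under both and its count is
    -- recorded.
    have h0 : p l g ≠ 0 := hg.elim id fun h => mt (hZ' g).1 h
    have := congrFun hc g
    simpa [pricedDemand, h0, mt (hZ' g).2 h0] using this

/-! ### Counting priced demand vectors -/

theorem card_pricedDemands_le {k : Fin m → Fin m → ℕ} (hk : ∀ g, k g g = 0)
    (Z : Finset (Fin m)) : (pricedDemands n k Z).card ≤ (n + (m - Z.card)).choose n := by
  classical
  -- Stars and bars: `none` carries the slack, turning the bound on the sum into an equality; free
  -- goods have count `0` by `hk`.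
  let f : (Fin m → Fin (n + 1)) → Option {h // h ∉ Z} → ℕ := fun c o =>
    o.elim (n - ∑ h, (c h : ℕ)) fun h => c h
  have h0 : ∀ c ∈ pricedDemands n k Z, ∀ g ∈ Z, (c g : ℕ) = 0 := fun c hc g hg =>
    Nat.le_zero.1 (((Finset.mem_filter.1 hc).2.2 g hg g).trans_eq (hk g))
  have hle : (pricedDemands n k Z).card ≤
      (Finset.piAntidiag (Finset.univ : Finset (Option {h // h ∉ Z})) n).card := by
    refine Finset.card_le_card_of_injOn f ?_ ?_
    · intro c hc
      refine Finset.mem_coe.2 (Finset.mem_piAntidiag.2 ⟨?_, fun _ _ => Finset.mem_univ _⟩)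
      have hs : ∑ h : {h // h ∉ Z}, (c h : ℕ) = ∑ h, (c h : ℕ) := by
        rw [← Finset.sum_subtype (Finset.univ.filter fun h => h ∉ Z) (by simp)
          (fun h => (c h : ℕ))]
        refine Finset.sum_subset (Finset.subset_univ _) fun g _ hg => h0 c hc g ?_
        simpa using hg
      rw [Fintype.sum_option]
      simp only [Option.elim]
      rw [hs]
      exact Nat.sub_add_cancel (Finset.mem_filter.1 hc).2.1
    · intro c hc c' hc' h
      funext g
      by_cases hg : g ∈ Z
      · exact Fin.ext ((h0 c hc g hg).trans (h0 c' hc' g hg).symm)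
      · exact Fin.ext (congrFun h (some ⟨g, hg⟩))
  refine hle.trans_eq ?_
  rw [← Finset.map_sym_eq_piAntidiag, Finset.card_map, Finset.sym_univ, Finset.card_univ,
    Sym.card_sym_eq_choose, Fintype.card_option]
  simp only [Fintype.card_subtype_compl, Fintype.card_fin, Fintype.card_coe]
  congr 1
  omega

theorem sum_card_pricedDemands_le {k : Fin m → Fin m → ℕ} (hk : ∀ g, k g g = 0) :
    ∑ Z, (pricedDemands n k Z).card ≤
      ∑ j ∈ Finset.range (m + 1), m.choose j * (n + (m - j)).choose n := by
  refine (Finset.sum_le_sum fun Z _ => card_pricedDemands_le hk Z).trans_eq ?_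
  rw [← Finset.powerset_univ,
    Finset.sum_powerset_apply_card (fun j => (n + (m - j)).choose n)]
  simp

/-! ### Three goods and four buyers -/

/-- The number of pairs `(x, y)` with `x ≤ a`, `y ≤ b` and `x + y ≤ 4`. -/
def cornerCount (a b : ℕ) : ℕ :=
  (Finset.univ.filter fun x : Fin 5 × Fin 5 =>
    (x.1 : ℕ) + x.2 ≤ 4 ∧ (x.1 : ℕ) ≤ a ∧ (x.2 : ℕ) ≤ b).card

theorem cornerCount_mono {a b a' b' : ℕ} (ha : a ≤ a') (hb : b ≤ b') :
    cornerCount a b ≤ cornerCount a' b' :=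
  Finset.card_le_card fun _ hx => Finset.mem_filter.2 ⟨Finset.mem_univ _,
    (Finset.mem_filter.1 hx).2.1, (Finset.mem_filter.1 hx).2.2.1.trans ha,
    (Finset.mem_filter.1 hx).2.2.2.trans hb⟩

theorem card_pricedDemands_singleton_le {k : Fin 3 → Fin 3 → ℕ} (hk : ∀ g, k g g = 0)
    {g h i : Fin 3} (hu : ∀ f : Fin 3 → ℕ, ∑ j, f j = f g + f h + f i)
    (hghi : ∀ j, j = g ∨ j = h ∨ j = i) :
    (pricedDemands 4 k {g}).card ≤ cornerCount (k g h) (k g i) := by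
  have h0 : ∀ c ∈ pricedDemands 4 k {g}, (∑ j, (c j : ℕ) ≤ 4) ∧ ∀ j, (c j : ℕ) ≤ k g j :=
    fun c hc => ⟨(Finset.mem_filter.1 hc).2.1,
      (Finset.mem_filter.1 hc).2.2 g (Finset.mem_singleton_self g)⟩
  refine Finset.card_le_card_of_injOn (fun c => (c h, c i)) ?_ ?_
  · intro c hc
    obtain ⟨h1, h2⟩ := h0 c hc
    rw [hu] at h1
    exact Finset.mem_coe.2 (Finset.mem_filter.2 ⟨Finset.mem_univ _, by dsimp only; omega,
      h2 h, h2 i⟩)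
  · intro c hc c' hc' heq
    have h1 := (h0 c hc).2 g
    have h2 := (h0 c' hc').2 g
    rw [hk] at h1 h2
    obtain ⟨h3, h4⟩ := Prod.mk.inj heq
    funext j
    rcases hghi j with rfl | rfl | rfl
    · exact Fin.ext (by omega)
    · exact h3
    · exact h4

/-- The coarse count gives `96 > 81` for three goods. Opposite strict preferences share the four
buyers, so the three one-free-good terms cannot all be large: they total at most `27` instead of
`45`. -/
theorem cornerCount_tournament_le (a b c : Fin 5) :
    cornerCount a b + cornerCount (4 - a) c + cornerCount (4 - b) (4 - c) ≤ 27 := by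
  revert a b c
  decide +kernel

theorem sum_card_pricedDemands_three_le {k : Fin 3 → Fin 3 → ℕ} (hk : ∀ g, k g g = 0)
    (hk' : ∀ g h, k g h + k h g ≤ 4) : ∑ Z, (pricedDemands 4 k Z).card ≤ 78 := by
  have hsum : ∀ f : Finset (Fin 3) → ℕ, ∑ Z, f Z = f ∅ + (f {0} + f {1} + f {2}) +
      (f {0, 1} + f {0, 2} + f {1, 2}) + f {0, 1, 2} := by
    intro f
    rw [show (Finset.univ : Finset (Finset (Fin 3))) =
      {∅, {0}, {1}, {2}, {0, 1}, {0, 2}, {1, 2}, {0, 1, 2}} by decide]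
    repeat rw [Finset.sum_insert (by decide)]
    rw [Finset.sum_singleton]
    ring
  have c0 := card_pricedDemands_le (n := 4) hk ∅
  have c01 := card_pricedDemands_le (n := 4) hk {0, 1}
  have c02 := card_pricedDemands_le (n := 4) hk {0, 2}
  have c12 := card_pricedDemands_le (n := 4) hk {1, 2}
  have c012 := card_pricedDemands_le (n := 4) hk {0, 1, 2}
  have s0 := card_pricedDemands_singleton_le hk (g := 0) (h := 1) (i := 2)
    (fun f => by rw [Fin.sum_univ_three]) (by decide)
  have s1 := card_pricedDemands_singleton_le hk (g := 1) (h := 0) (i := 2)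
    (fun f => by rw [Fin.sum_univ_three]; ring) (by decide)
  have s2 := card_pricedDemands_singleton_le hk (g := 2) (h := 0) (i := 1)
    (fun f => by rw [Fin.sum_univ_three]; ring) (by decide)
  have k01 := hk' 0 1
  have k02 := hk' 0 2
  have k12 := hk' 1 2
  have t := cornerCount_tournament_le ⟨k 0 1, by omega⟩ ⟨k 0 2, by omega⟩ ⟨k 1 2, by omega⟩
  have m1 := cornerCount_mono (show k 1 0 ≤ 4 - k 0 1 by omega) (le_refl (k 1 2))
  have m2 := cornerCount_mono (show k 2 0 ≤ 4 - k 0 2 by omega)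
    (show k 2 1 ≤ 4 - k 1 2 by omega)
  rw [show ((4 : ℕ) + (3 - (∅ : Finset (Fin 3)).card)).choose 4 = 35 by decide] at c0
  rw [show ((4 : ℕ) + (3 - ({0, 1} : Finset (Fin 3)).card)).choose 4 = 5 by decide] at c01
  rw [show ((4 : ℕ) + (3 - ({0, 2} : Finset (Fin 3)).card)).choose 4 = 5 by decide] at c02
  rw [show ((4 : ℕ) + (3 - ({1, 2} : Finset (Fin 3)).card)).choose 4 = 5 by decide] at c12
  rw [show ((4 : ℕ) + (3 - ({0, 1, 2} : Finset (Fin 3)).card)).choose 4 = 1 by decide] at c012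
  rw [hsum]
  dsimp only at t
  omega

theorem ncard_inducedLabelings_le_choose_mul_pow (he : IsEncodable e)
    (hV : ∀ v ∈ V, v.IsUnitDemand) (hm : 3 ≤ m) (hn : m + 1 ≤ n) (s : Fin n → V) :
    (inducedLabelings (bundlePredictors e) s).ncard ≤ n.choose (m + 1) * m ^ (m + 1) := by
  have hgen := ncard_inducedLabelings_le he s
  rcases le_or_gt 6 m with hm6 | hm6
  · refine hgen.trans (succ_pow_le_choose_mul le_rfl ?_ hn)
    simpa using add_two_pow_le_pow_succ hm6
  -- At `n = m + 2` the binomial factor `m + 2` leaves enough room; at `n = m + 1` it is `1` and the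
  -- general bound is too weak.
  rcases hn.lt_or_eq with hlt | rfl
  · refine hgen.trans (succ_pow_le_choose_mul (n₀ := m + 2) (by omega) ?_ hlt)
    interval_cases m <;> decide
  · have hsum := ncard_inducedLabelings_le_sum he hV s
    have hk := preferenceCount_self s
    rw [Nat.choose_self, one_mul]
    have hcoarse := hsum.trans (sum_card_pricedDemands_le hk)
    interval_cases m
    · exact hsum.trans ((sum_card_pricedDemands_three_le hk (preferenceCount_add_le s)).trans
        (by norm_num))
    · exact hcoarse.trans (by decide)
    · exact hcoarse.trans (by decide)

end Market

theorem mainTheorem8 :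
    -- pseudo-dimension of the welfare predictors, general valuations
    (∃ C : ℝ, 0 < C ∧ ∀ (m : ℕ), 2 ≤ m → ∀ (H : ℝ) (V : Set (Market.BundleValuation m H))
      (e : Market.TieBreaking V), Market.IsEncodable e →
      ∃ d : ℕ, Market.pseudoDim (Market.welfarePredictors e) = (d : ℕ∞) ∧
        (d : ℝ) ≤ C * ((m : ℝ) ^ 2 * Real.log (m : ℝ))) ∧
    -- pseudo-dimension of the welfare predictors, unit demand valuations
    (∃ C : ℝ, 0 < C ∧ ∀ (m : ℕ), 2 ≤ m → ∀ (H : ℝ) (V : Set (Market.BundleValuation m H))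
      (e : Market.TieBreaking V), (∀ v ∈ V, v.IsUnitDemand) → Market.IsEncodable e →
      ∃ d : ℕ, Market.pseudoDim (Market.welfarePredictors e) = (d : ℕ∞) ∧
        (d : ℝ) ≤ C * ((m : ℝ) * Real.log (m : ℝ) ^ 3)) ∧
    -- number of bundle labelings of a sample of `n ≥ m + 1` valuations
    (∀ (m : ℕ) (H : ℝ) (V : Set (Market.BundleValuation m H)) (e : Market.TieBreaking V),
      Market.IsEncodable e → ∀ (n : ℕ), m + 1 ≤ n → ∀ (s : Fin n → V),
      (Market.inducedLabelings (Market.bundlePredictors e) s).ncard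
          ≤ n.choose (m + 1) * 2 ^ (m * (m + 1)) ∧
      ((∀ v ∈ V, v.IsUnitDemand) →
        (Market.inducedLabelings (Market.bundlePredictors e) s).ncard
            ≤ n.choose (m + 1) * (m + 1) ^ (m + 1) ∧
        (3 ≤ m → (Market.inducedLabelings (Market.bundlePredictors e) s).ncard
            ≤ n.choose (m + 1) * m ^ (m + 1)))) := by
  refine ⟨⟨5, by norm_num, fun m hm H V e he => ?_⟩,
    ⟨15, by norm_num, fun m hm H V e _ he => ?_⟩, fun m H V e he n hn s => ⟨?_, fun hV => ⟨?_,
      fun hm => Market.ncard_inducedLabelings_le_choose_mul_pow he hV hm hn s⟩⟩⟩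
  · have hm' : (2 : ℝ) ≤ m := by exact_mod_cast hm
    have hlog : 0 ≤ Real.log m := Real.log_nonneg (by linarith)
    refine Market.exists_pseudoDim_eq he (by positivity) fun d hd =>
      (Market.le_mul_log_of_two_pow_le hm hd).trans ?_
    gcongr
    nlinarith
  · have hm' : (2 : ℝ) ≤ m := by exact_mod_cast hm
    have hlog : 0.6 ≤ Real.log m := by
      have := Real.log_le_log (by norm_num) hm'
      linarith [Real.log_two_gt_d9]
    refine Market.exists_pseudoDim_eq he (by positivity) fun d hd =>
      (Market.le_mul_log_of_two_pow_le hm hd).trans ?_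
    -- Since `3 * 0.6 ^ 2 > 1`; hence the constant `15 = 5 * 3`.
    have h1 : Real.log m ≤ 3 * Real.log m ^ 3 := by
      nlinarith [mul_nonneg (sub_nonneg.2 hlog) (sub_nonneg.2 hlog)]
    nlinarith [mul_le_mul_of_nonneg_left h1 (by positivity : (0 : ℝ) ≤ m)]
  · refine (Market.ncard_inducedLabelings_le he s).trans
      (Market.succ_pow_le_choose_mul le_rfl ?_ hn)
    rw [Nat.choose_self, one_mul, mul_comm, pow_mul]
    exact Nat.pow_le_pow_left (Nat.lt_two_pow_self) m
  · refine (Market.ncard_inducedLabelings_le he s).trans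
      (Market.succ_pow_le_choose_mul le_rfl ?_ hn)
    simpa using Market.succ_pow_mul_sub_le (m + 1) m
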